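/- Let $G$ be a finite group, $p$ a prime and $\mathbf Z_{(p)}$ the localization of $\mathbf Z$ at $p$. A \emph{Mackey functor} $\mathcal M$ for $G$ assigns to each finite $G$-set $X$ an abelian group $\mathcal M(X)$ and to each $G$-map $f\colon X\to Y$ homomorphisms $f^*\colon \mathcal M(Y)\to \mathcal M(X)$ (restriction) and $f_*\colon \mathcal M(X)\to\mathcal M(Y)$ (induction), functorially, such that $g^*f_*=b_*a^*$ for every pullback square $f\circ a=g\circ b$ of finite $G$-sets, and such that restriction to the two summands gives an isomorphism $\mathcal M(X\sqcup Y)\cong\mathcal M(X)\oplus\mathcal M(Y)$. For $H\le G$ write $\mathcal M(H)=\mathcal M(G/H)$, and let $\mathrm{Res}_G^H\colon \mathcal M(G)\to\mathcal M(H)$ and $\mathrm{Ind}_H^G\colon\mathcal M(H)\to\mathcal M(G)$ be restriction and induction along $G/H\to G/G$. The Mackey functor $\mathcal M\otimes\mathbf Z_{(p)}$ is $X\mapsto\mathcal M(X)\otimes\mathbf Z_{(p)}$. A \emph{Green ring} $\mathcal G$ is a Mackey functor whose values are associative rings with unit, such that every $f^*$ is a unital ring homomorphism and $a\cdot f_*(b)=f_*(f^*(a)\cdot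 b)$, $f_*(a)\cdot b=f_*(a\cdot f^*(b))$. It \emph{acts} on $\mathcal M$ if each $\mathcal M(X)$ is a unital $\mathcal G(X)$-module, with $f^*(a\cdot x)=f^*(a)\cdot f^*(x)$, $a\cdot f_*(x)=f_*(f^*(a)\cdot x)$ and $f_*(a)\cdot x=f_*(a\cdot f^*(x))$. A \emph{family} $\mathcal F$ of subgroups of $G$ is a collection of subgroups closed under conjugation and under taking subgroups. It is \emph{$hyper_p$-closed} if $H\in\mathcal F$ whenever there is $K\in\mathcal F$ such that $K$ is a normal subgroup of $H\le G$ and $H/K$ is a $p$-group. A Mackey functor $\mathcal N$ is \emph{$\mathcal F$-computable} if, for $X=\bigsqcup_{H\in\mathcal F}G/H$, both Amitsur complexes $$\mathcal N(G)\to\mathcal N(X)\to\mathcal N(X\times X)\to\cdots \qquad\text{and}\qquad \cdots\to\mathcal N(X\times X)\to\mathcal N(X)\to\mathcal N(G)$$ are contractible (chain homotopy equivalent to $0$); their boundary maps are the alternating sums of the restrictions, respectively the inductions, along the projections $X^{n+1}\to X^n$ that omit one coordinate. Note that $\mathcal N(X)\cong\bigoplus_{H\in\mathcal F}\mathcal N(H)$.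 \textbf{Theorem.} Let $\mathcal G$ be a Green ring acting on a Mackey functor $\mathcal M$, and let $\mathcal F$ be a $hyper_p$-closed family of subgroups of $G$. If $\mathcal G\otimes\mathbf Z_{(p)}$ is $\mathcal F$-computable, then every $x\in\mathcal M(G)\otimes\mathbf Z_{(p)}$ can be written as $$x=\sum_{H\in\mathcal F}a_H\,\mathrm{Ind}_H^G(\mathrm{Res}_G^H(x))$$ for some coefficients $a_H\in\mathbf Z_{(p)}$. -/

import Mathlib

open CategoryTheory
open scoped TensorProduct

universe u v w

/-! ### Finite `G`-sets -/

/-- A finite (left) `G`-set. Morphisms are the equivariant maps `X →[G] Y`. -/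
structure FinGSet (G : Type u) [Group G] where
  carrier : Type u
  [action : MulAction G carrier]
  [finite : Finite carrier]

attribute [instance] FinGSet.action FinGSet.finite

instance (G : Type u) [Group G] : CoeSort (FinGSet G) (Type u) := ⟨FinGSet.carrier⟩

namespace FinGSet

variable {G : Type u} [Group G]

/-- The disjoint union of two finite `G`-sets. -/
abbrev disjUnion (X Y : FinGSet G) : FinGSet G := ⟨X ⊕ Y⟩

/-- The inclusion of the first summand. -/
def inl (X Y : FinGSet G) : X →[G] disjUnion X Y where
  toFun := Sum.inl
  map_smul' _ _ := rfl

/-- The inclusion of the second summand. -/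
def inr (X Y : FinGSet G) : Y →[G] disjUnion X Y where
  toFun := Sum.inr
  map_smul' _ _ := rfl

/-- The cartesian power `X ^ n` with the diagonal action; `X ^ 0` is a one-point `G`-set. -/
abbrev pow (X : FinGSet G) (n : ℕ) : FinGSet G := ⟨Fin n → X⟩

/-- The projection `X ^ (n + 1) → X ^ n` that omits the `i`-th coordinate. -/
def dropCoord (X : FinGSet G) (n : ℕ) (i : Fin (n + 1)) : pow X (n + 1) →[G] pow X n where
  toFun x := fun j => x (i.succAbove j)
  map_smul' _ _ := rfl

/-- The transitive `G`-set `G / H`. -/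
abbrev quot [Finite G] (H : Subgroup G) : FinGSet G := ⟨G ⧸ H⟩

/-- The projection `G / H → G / K` for `H ≤ K`. -/
def quotMap [Finite G] {H K : Subgroup G} (h : H ≤ K) : quot H →[G] quot K where
  toFun := Subgroup.quotientMapOfLE h
  map_smul' g x := by
    induction x using QuotientGroup.induction_on with
    | H a => rfl

/-- The `G`-set `⨆_{H ∈ F} G / H`, for a set `F` of subgroups of `G`. -/
abbrev ofFamily [Finite G] (F : Set (Subgroup G)) : FinGSet G := ⟨Σ H : F, G ⧸ (H : Subgroup G)⟩

end FinGSet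

/-! ### Mackey functors -/

/-- A Mackey functor (in the sense of Dress) on finite `G`-sets with values in `R`-modules.
For `R = ℤ` these are the Mackey functors with values in abelian groups. -/
structure MackeyFunctor (R : Type w) [CommRing R] (G : Type u) [Group G] where
  obj : FinGSet G → Type v
  [addCommGroup : ∀ X, AddCommGroup (obj X)]
  [module : ∀ X, Module R (obj X)]
  /-- The contravariant part (restriction). -/
  res : ∀ {X Y : FinGSet G}, (X →[G] Y) → (obj Y →ₗ[R] obj X)
  /-- The covariant part (induction). -/
  ind : ∀ {X Y : FinGSet G}, (X →[G] Y) → (obj X →ₗ[R] obj Y)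
  res_id : ∀ X : FinGSet G, res (MulActionHom.id G : X →[G] X) = LinearMap.id
  res_comp : ∀ {X Y Z : FinGSet G} (g : Y →[G] Z) (f : X →[G] Y),
    res (g.comp f) = res f ∘ₗ res g
  ind_id : ∀ X : FinGSet G, ind (MulActionHom.id G : X →[G] X) = LinearMap.id
  ind_comp : ∀ {X Y Z : FinGSet G} (g : Y →[G] Z) (f : X →[G] Y),
    ind (g.comp f) = ind g ∘ₗ ind f
  /-- The base change formula for every pullback square of finite `G`-sets
  `f ∘ a = g ∘ b`, with `a : W → X`, `b : W → Y`, `f : X → Z`, `g : Y → Z`. -/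
  res_ind : ∀ {W X Y Z : FinGSet G} (a : W →[G] X) (b : W →[G] Y) (f : X →[G] Z) (g : Y →[G] Z),
    (∀ t, f (a t) = g (b t)) → (∀ x y, f x = g y → ∃! t, a t = x ∧ b t = y) →
      res g ∘ₗ ind f = ind b ∘ₗ res a
  /-- Disjoint unions go to direct sums. -/
  additive : ∀ X Y : FinGSet G, Function.Bijective
    ((res (FinGSet.inl X Y)).prod (res (FinGSet.inr X Y)))

attribute [instance] MackeyFunctor.addCommGroup MackeyFunctor.module

namespace MackeyFunctor

section

variable {R : Type w} [CommRing R] {G : Type u} [Group G]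

/-- The Mackey functor `M ⊗ A`, `X ↦ A ⊗ M(X)`, for a commutative `R`-algebra `A`. -/
noncomputable def baseChange (M : MackeyFunctor.{u, v, w} R G) (A : Type w) [CommRing A]
    [Algebra R A] : MackeyFunctor.{u, max v w, w} A G where
  obj X := A ⊗[R] M.obj X
  res f := (M.res f).baseChange A
  ind f := (M.ind f).baseChange A
  res_id X := by rw [M.res_id, LinearMap.baseChange_id]
  res_comp g f := by rw [M.res_comp, LinearMap.baseChange_comp]
  ind_id X := by rw [M.ind_id, LinearMap.baseChange_id]
  ind_comp g f := by rw [M.ind_comp, LinearMap.baseChange_comp]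
  res_ind a b f g h h' := by
    rw [← LinearMap.baseChange_comp, ← LinearMap.baseChange_comp, M.res_ind a b f g h h']
  additive X Y := by
    let e := LinearEquiv.ofBijective _ (M.additive X Y)
    let e' := (e.baseChange R A _ _).trans (TensorProduct.prodRight R A A (M.obj X) (M.obj Y))
    convert e'.bijective using 1
    funext z
    induction z using TensorProduct.induction_on with
    | zero => simp
    | tmul a m => rfl
    | add z z' h h' => rw [map_add, h, h', map_add]

variable [Finite G] (M : MackeyFunctor.{u, v, w} R G)

/-- The value `M(H)` at a subgroup `H` of `G`, that is, `M(G / H)`. -/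
abbrev valueAt (H : Subgroup G) : Type v := M.obj (FinGSet.quot H)

/-- The induction `Ind_H^G : M(H) → M(G)`. -/
abbrev Ind (H : Subgroup G) : M.valueAt H →ₗ[R] M.valueAt (⊤ : Subgroup G) :=
  M.ind (FinGSet.quotMap (le_top : H ≤ ⊤))

/-- The restriction `Res_G^H : M(G) → M(H)`. -/
abbrev Res (H : Subgroup G) : M.valueAt (⊤ : Subgroup G) →ₗ[R] M.valueAt H :=
  M.res (FinGSet.quotMap (le_top : H ≤ ⊤))

end

end MackeyFunctor

/-! ### Amitsur complexes and computability -/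

/-- The cancellation behind the identity `d ∘ d = 0` in the Amitsur complexes. -/
theorem amitsur_cancel {E : Type*} [AddCommGroup E] (n : ℕ)
    (T : Fin (n + 2) → Fin (n + 1) → E)
    (hT : ∀ i j : Fin (n + 1), i ≤ j → T i.castSucc j = T j.succ i) :
    ∑ j : Fin (n + 2), ∑ i : Fin (n + 1), ((-1 : ℤ) ^ (j : ℕ) * (-1) ^ (i : ℕ)) • T j i = 0 := by
  rw [← Fintype.sum_prod_type']
  let P := Fin (n + 2) × Fin (n + 1)
  let S : Finset P := {ij : P | (ij.2 : ℕ) < (ij.1 : ℕ)}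
  rw [← Finset.sum_add_sum_compl S, ← eq_neg_iff_add_eq_zero, ← Finset.sum_neg_distrib]
  let φ : ∀ ij : P, ij ∈ S → P := fun ij hij =>
    (Fin.castSucc ij.2,
      ij.1.pred fun hij' => by
        simp only [S, Finset.mem_filter_univ, hij'] at hij
        simp at hij)
  refine Finset.sum_bij φ ?_ ?_ ?_ ?_
  · rintro ⟨j, i⟩ h
    simp only [S, Finset.mem_filter_univ, Finset.mem_compl, φ, Fin.val_pred,
      Fin.val_castSucc] at h ⊢
    omega
  · rintro ⟨j, i⟩ h ⟨j', i'⟩ h' heq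
    have h1 := congrArg Prod.fst heq
    have h2 := congrArg Prod.snd heq
    simp only [φ, Fin.castSucc_inj, Fin.pred_inj] at h1 h2
    rw [h1, h2]
  · rintro ⟨j, i⟩ h
    simp only [S, Finset.mem_filter_univ, Finset.mem_compl, not_lt] at h
    have hj : (j : ℕ) < n + 1 := lt_of_le_of_lt h i.2
    refine ⟨(i.succ, ⟨j, hj⟩), ?_, ?_⟩
    · simp only [S, Finset.mem_filter_univ, Fin.val_succ]
      omega
    · simp [φ]
  · rintro ⟨j, i⟩ h
    simp only [S, Finset.mem_filter_univ] at h
    have hj : j ≠ 0 := by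
      rintro rfl
      simp at h
    obtain ⟨k, rfl⟩ := Fin.exists_succ_eq.mpr hj
    have hik : i ≤ k := by
      rw [Fin.le_def]
      simp only [Fin.val_succ] at h
      omega
    simp only [φ, Fin.pred_succ, hT i k hik, Fin.val_succ, Fin.val_castSucc, ← neg_smul]
    congr 1
    ring

/-- Omitting two coordinates, in either order. -/
theorem FinGSet.dropCoord_comp {G : Type u} [Group G] (X : FinGSet G) (n : ℕ)
    (i j : Fin (n + 1)) (hij : i ≤ j) :
    (X.dropCoord n j).comp (X.dropCoord (n + 1) i.castSucc) =
      (X.dropCoord n i).comp (X.dropCoord (n + 1) j.succ) := by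
  ext x k
  change x (i.castSucc.succAbove (j.succAbove k)) = x (j.succ.succAbove (i.succAbove k))
  congr 1
  ext
  simp only [Fin.succAbove, Fin.lt_def, Fin.le_def] at hij ⊢
  split_ifs <;> simp_all <;> omega

namespace MackeyFunctor

variable {R : Type w} [CommRing R] {G : Type u} [Group G] (M : MackeyFunctor.{u, v, w} R G)

/-- The boundary map `M(X ^ n) → M(X ^ (n + 1))`, the alternating sum of the restriction maps
along the projections. -/
def amitsurResD (X : FinGSet G) (n : ℕ) : M.obj (X.pow n) →ₗ[R] M.obj (X.pow (n + 1)) :=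
  ∑ i : Fin (n + 1), (-1 : ℤ) ^ (i : ℕ) • M.res (X.dropCoord n i)

/-- The boundary map `M(X ^ (n + 1)) → M(X ^ n)`, the alternating sum of the induction maps
along the projections. -/
def amitsurIndD (X : FinGSet G) (n : ℕ) : M.obj (X.pow (n + 1)) →ₗ[R] M.obj (X.pow n) :=
  ∑ i : Fin (n + 1), (-1 : ℤ) ^ (i : ℕ) • M.ind (X.dropCoord n i)

theorem amitsurResD_comp (X : FinGSet G) (n : ℕ) :
    M.amitsurResD X (n + 1) ∘ₗ M.amitsurResD X n = 0 := by
  have h := amitsur_cancel n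
    (fun j i => M.res (X.dropCoord (n + 1) j) ∘ₗ M.res (X.dropCoord n i)) (by
      intro i j hij
      simp only [← M.res_comp, X.dropCoord_comp n i j hij])
  rw [← h]
  ext m
  simp [amitsurResD, Finset.smul_sum, smul_smul, LinearMap.sum_apply, map_sum]

theorem amitsurIndD_comp (X : FinGSet G) (n : ℕ) :
    M.amitsurIndD X n ∘ₗ M.amitsurIndD X (n + 1) = 0 := by
  have h := amitsur_cancel n
    (fun j i => M.ind (X.dropCoord n i) ∘ₗ M.ind (X.dropCoord (n + 1) j)) (by
      intro i j hij
      simp only [← M.ind_comp, X.dropCoord_comp n i j hij])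
  rw [← h, Finset.sum_comm]
  ext m
  simp [amitsurIndD, Finset.smul_sum, smul_smul, LinearMap.sum_apply, map_sum, mul_comm]

/-- The (augmented) Amitsur complex `M(•) → M(X) → M(X × X) → ⋯` of restriction maps. -/
noncomputable def amitsurRes (X : FinGSet G) : CochainComplex (ModuleCat.{v} R) ℕ :=
  CochainComplex.of (fun n => ModuleCat.of R (M.obj (X.pow n)))
    (fun n => ModuleCat.ofHom (M.amitsurResD X n))
    (fun n => by rw [← ModuleCat.ofHom_comp, M.amitsurResD_comp]; rfl)

/-- The (augmented) Amitsur complex `⋯ → M(X × X) → M(X) → M(•)` of induction maps. -/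
noncomputable def amitsurInd (X : FinGSet G) : ChainComplex (ModuleCat.{v} R) ℕ :=
  ChainComplex.of (fun n => ModuleCat.of R (M.obj (X.pow n)))
    (fun n => ModuleCat.ofHom (M.amitsurIndD X n))
    (fun n => by rw [← ModuleCat.ofHom_comp, M.amitsurIndD_comp]; rfl)

/-- `M` is `F`-computable if both Amitsur complexes for the `G`-set `⨆_{H ∈ F} G / H`
are contractible. Their first terms are `M(G)` and `⨁_{H ∈ F} M(H)`. -/
def IsComputable [Finite G] (F : Set (Subgroup G)) : Prop :=
  Nonempty (Homotopy (𝟙 (M.amitsurRes (FinGSet.ofFamily F))) 0) ∧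
    Nonempty (Homotopy (𝟙 (M.amitsurInd (FinGSet.ofFamily F))) 0)

end MackeyFunctor

/-! ### Green rings and their actions -/

/-- A Green ring (Green functor): a Mackey functor whose values are associative unital
`R`-algebras, such that restrictions are ring homomorphisms and Frobenius reciprocity holds. -/
structure GreenFunctor (R : Type w) [CommRing R] (G : Type u) [Group G] where
  toMackey : MackeyFunctor.{u, v, w} R G
  mul : ∀ X, toMackey.obj X →ₗ[R] toMackey.obj X →ₗ[R] toMackey.obj X
  one : ∀ X, toMackey.obj X
  mul_assoc : ∀ X (a b c : toMackey.obj X), mul X (mul X a b) c = mul X a (mul X b c)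
  one_mul : ∀ X (a : toMackey.obj X), mul X (one X) a = a
  mul_one : ∀ X (a : toMackey.obj X), mul X a (one X) = a
  res_mul : ∀ {X Y : FinGSet G} (f : X →[G] Y) (a b : toMackey.obj Y),
    toMackey.res f (mul Y a b) = mul X (toMackey.res f a) (toMackey.res f b)
  res_one : ∀ {X Y : FinGSet G} (f : X →[G] Y), toMackey.res f (one Y) = one X
  mul_ind : ∀ {X Y : FinGSet G} (f : X →[G] Y) (a : toMackey.obj Y) (b : toMackey.obj X),
    mul Y a (toMackey.ind f b) = toMackey.ind f (mul X (toMackey.res f a) b)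
  ind_mul : ∀ {X Y : FinGSet G} (f : X →[G] Y) (a : toMackey.obj X) (b : toMackey.obj Y),
    mul Y (toMackey.ind f a) b = toMackey.ind f (mul X a (toMackey.res f b))

/-- An action of a Green ring `A` on a Mackey functor `M`: each `M(X)` is a unital `A(X)`-module,
compatibly with restriction, and Frobenius reciprocity holds. -/
structure GreenAction {R : Type*} [CommRing R] {G : Type u} [Group G]
    (A : GreenFunctor.{u, v} R G) (M : MackeyFunctor.{u, w} R G) where
  smul : ∀ X, A.toMackey.obj X →ₗ[R] M.obj X →ₗ[R] M.obj X
  one_smul : ∀ X (x : M.obj X), smul X (A.one X) x = x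
  mul_smul : ∀ X (a b : A.toMackey.obj X) (x : M.obj X),
    smul X (A.mul X a b) x = smul X a (smul X b x)
  res_smul : ∀ {X Y : FinGSet G} (f : X →[G] Y) (a : A.toMackey.obj Y) (x : M.obj Y),
    M.res f (smul Y a x) = smul X (A.toMackey.res f a) (M.res f x)
  smul_ind : ∀ {X Y : FinGSet G} (f : X →[G] Y) (a : A.toMackey.obj Y) (x : M.obj X),
    smul Y a (M.ind f x) = M.ind f (smul X (A.toMackey.res f a) x)
  ind_smul : ∀ {X Y : FinGSet G} (f : X →[G] Y) (a : A.toMackey.obj X) (x : M.obj Y),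
    smul Y (A.toMackey.ind f a) x = M.ind f (smul X a (M.res f x))

/-! ### Families of subgroups -/

/-- A family of subgroups: a collection closed under conjugation and under taking subgroups. -/
structure IsSubgroupFamily {G : Type u} [Group G] (F : Set (Subgroup G)) : Prop where
  conj_mem : ∀ H ∈ F, ∀ g : G, H.map (MulAut.conj g).toMonoidHom ∈ F
  mem_of_le : ∀ H ∈ F, ∀ K ≤ H, K ∈ F

/-- The subgroups `H` of `G` such that `K` is a normal subgroup of `H` and `H / K` is a
`p`-group. -/
def pExtensions {G : Type u} [Group G] (p : ℕ) (K : Subgroup G) : Set (Subgroup G) :=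
  {H | K ≤ H ∧ ∃ _ : (K.subgroupOf H).Normal, IsPGroup p (H ⧸ K.subgroupOf H)}

/-- `F` is `hyper_p`-closed. -/
def IsHyperClosed {G : Type u} [Group G] (p : ℕ) (F : Set (Subgroup G)) : Prop :=
  ∀ K ∈ F, pExtensions p K ⊆ F

/-! ### The ring `ℤ_(p)` -/

instance isPrime_span_natCast (p : ℕ) [Fact p.Prime] : (Ideal.span {(p : ℤ)}).IsPrime :=
  (Ideal.span_singleton_prime (Int.natCast_ne_zero.mpr (Fact.out : p.Prime).ne_zero)).mpr
    (Nat.prime_iff_prime_int.mp Fact.out)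

/-- The localization of `ℤ` at the prime `p`. -/
abbrev IntLocal (p : ℕ) [Fact p.Prime] : Type := Localization.AtPrime (Ideal.span {(p : ℤ)})

/-! Put N = M ⊗ ℤ_(p) and T_H = Ind_H ∘ Res_H on N(G). It suffices that the identity of N(G) is a
ℤ_(p)-combination of the T_H with H ∈ F (`one_mem_transferSpan`); the coefficients then do not even
depend on x.

The contraction of the induction complex shows that the unit of the Green ring is induced from F. By
Frobenius reciprocity N(G) is then the sum of the images of Ind_K, K ∈ F (`iSup_range_Ind_eq_top`).
Base change over the point makes the span of the T_H commutative and closed under products. Hence,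
if s and t in the span fix two submodules pointwise, s + t - st fixes both, and it is enough to fix
the image of a single Ind_K.

This is done by induction on |K|. Modulo images from smaller members of F, T_H acts on the image of
Ind_K as the number of K-fixed points of G/H (`transfer_Ind_sub_mem`). Some H ∈ F makes this number
prime to p (`exists_not_dvd_card_fixed`): p-extensions preserve it modulo p and stay in F, so K may
be enlarged until p does not divide |N(K)/K|, the number of K-fixed points of G/K. Dividing T_H by
this unit leaves an error that the induction hypothesis absorbs. -/

/-! ### Decomposition of finite G-sets into orbits -/

namespace FinGSet

variable {G : Type u} [Group G]

/-- The cartesian product of two finite `G`-sets. -/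
abbrev prod (X Y : FinGSet G) : FinGSet G := ⟨X × Y⟩

/-- The first projection. -/
def fst (X Y : FinGSet G) : prod X Y →[G] X where
  toFun := Prod.fst
  map_smul' _ _ := rfl

/-- The second projection. -/
def snd (X Y : FinGSet G) : prod X Y →[G] Y where
  toFun := Prod.snd
  map_smul' _ _ := rfl

/-- An invariant subset, as a finite `G`-set. -/
abbrev ofSub {Y : FinGSet G} (s : SubMulAction G Y) : FinGSet G := ⟨s⟩

/-- The complement of an orbit. -/
def orbitCompl {Y : FinGSet G} (t : Y) : SubMulAction G Y where
  carrier := (MulAction.orbit G t)ᶜ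
  smul_mem' g y hy h := hy (by
    obtain ⟨k, hk⟩ := h
    exact ⟨g⁻¹ * k, by simp only [mul_smul] at hk ⊢; rw [hk, inv_smul_smul]⟩)

/-- Every finite `G`-set is built from transitive ones by disjoint unions. -/
theorem induction_on {P : FinGSet G → Prop} (Y : FinGSet G)
    (empty : ∀ Y : FinGSet G, IsEmpty Y → P Y)
    (trans : ∀ Y : FinGSet G, Nonempty Y → MulAction.IsPretransitive G Y → P Y)
    (union : ∀ (A B Y : FinGSet G) (f : A →[G] Y) (g : B →[G] Y),
      Function.Bijective (Sum.elim f g) → P A → P B → P Y) : P Y := by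
  obtain ⟨n, hn⟩ : ∃ n, Nat.card Y = n := ⟨_, rfl⟩
  induction n using Nat.strong_induction_on generalizing Y with
  | _ n ih =>
    subst hn
    rcases isEmpty_or_nonempty Y with h | ⟨⟨t⟩⟩
    · exact empty Y h
    · let A : FinGSet G := ⟨MulAction.orbit G t⟩
      let f : A →[G] Y := ⟨Subtype.val, fun _ _ => rfl⟩
      let g : ofSub (orbitCompl t) →[G] Y := ⟨Subtype.val, fun _ _ => rfl⟩
      refine union A (ofSub (orbitCompl t)) Y f g ⟨?_, fun y => ?_⟩ (trans A ?_ ?_)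
        (ih _ ?_ _ rfl)
      · refine Subtype.val_injective.sumElim Subtype.val_injective ?_
        rintro ⟨a, ha⟩ ⟨b, hb⟩ (rfl : a = b)
        exact hb ha
      · by_cases hy : y ∈ MulAction.orbit G t
        · exact ⟨Sum.inl ⟨y, hy⟩, rfl⟩
        · exact ⟨Sum.inr ⟨y, hy⟩, rfl⟩
      · exact ⟨⟨t, MulAction.mem_orbit_self t⟩⟩
      · exact inferInstanceAs (MulAction.IsPretransitive G (MulAction.orbit G t))
      · exact Finite.card_subtype_lt (x := t)
          (fun h => h (MulAction.mem_orbit_self t))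

theorem stabilizer_map_of_injective {X Y : FinGSet G} (f : X →[G] Y)
    (hf : Function.Injective f) (t : X) :
    MulAction.stabilizer G (f t) = MulAction.stabilizer G t := by
  ext g
  rw [MulAction.mem_stabilizer_iff, MulAction.mem_stabilizer_iff, ← map_smul, hf.eq_iff]

variable [Finite G]

/-- The map to the one-point `G`-set `G / G`. -/
def toPoint (Y : FinGSet G) : Y →[G] quot (⊤ : Subgroup G) where
  toFun _ := ((1 : G) : G ⧸ (⊤ : Subgroup G))
  map_smul' _ _ := QuotientGroup.subsingleton_quotient_top.elim _ _

theorem hom_point_ext {Y : FinGSet G} (f g : Y →[G] quot (⊤ : Subgroup G)) : f = g := by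
  ext y
  exact QuotientGroup.subsingleton_quotient_top.elim _ _

/-- The map `G / L → Y`, `g ↦ g • t`, at a point `t` fixed by `L`. -/
def orbitMap {Y : FinGSet G} (t : Y) (L : Subgroup G) (h : L ≤ MulAction.stabilizer G t) :
    quot L →[G] Y where
  toFun s := MulAction.ofQuotientStabilizer G t (Subgroup.quotientMapOfLE h s)
  map_smul' g s := by
    induction s using QuotientGroup.induction_on with
    | H a => exact mul_smul g a t

@[simp] theorem orbitMap_mk {Y : FinGSet G} (t : Y) (L : Subgroup G)
    (h : L ≤ MulAction.stabilizer G t) (g : G) : orbitMap t L h (g : G ⧸ L) = g • t := rfl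

theorem orbitMap_surjective {Y : FinGSet G} [MulAction.IsPretransitive G Y] (t : Y)
    (L : Subgroup G) (h : L ≤ MulAction.stabilizer G t) :
    Function.Surjective (orbitMap t L h) := fun y => by
  obtain ⟨g, rfl⟩ := MulAction.exists_smul_eq G t y
  exact ⟨(g : G ⧸ L), rfl⟩

theorem orbitMap_stabilizer_bijective {Y : FinGSet G} [MulAction.IsPretransitive G Y] (t : Y) :
    Function.Bijective (orbitMap t (MulAction.stabilizer G t) le_rfl) := by
  refine ⟨fun a b hab => ?_, orbitMap_surjective t _ _⟩
  induction a using QuotientGroup.induction_on with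
  | H a =>
    induction b using QuotientGroup.induction_on with
    | H b =>
      exact MulAction.injective_ofQuotientStabilizer G t hab

end FinGSet

/-! ### Consequences of the Mackey axioms; transfers through G-sets -/

namespace MackeyFunctor

open FinGSet

variable {R : Type w} [CommRing R] {G : Type u} [Group G] (N : MackeyFunctor.{u, v, w} R G)

theorem res_comp_apply {X Y Z : FinGSet G} (g : Y →[G] Z) (f : X →[G] Y) (z : N.obj Z) :
    N.res (g.comp f) z = N.res f (N.res g z) := by rw [N.res_comp]; rfl

theorem ind_comp_apply {X Y Z : FinGSet G} (g : Y →[G] Z) (f : X →[G] Y) (x : N.obj X) :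
    N.ind (g.comp f) x = N.ind g (N.ind f x) := by rw [N.ind_comp]; rfl

theorem res_ind_apply {W X Y Z : FinGSet G} (a : W →[G] X) (b : W →[G] Y) (f : X →[G] Z)
    (g : Y →[G] Z) (h : ∀ t, f (a t) = g (b t)) (h' : ∀ x y, f x = g y → ∃! t, a t = x ∧ b t = y)
    (x : N.obj X) : N.res g (N.ind f x) = N.ind b (N.res a x) :=
  LinearMap.congr_fun (N.res_ind a b f g h h') x

/-- The two inclusions of an empty X into X ⊔ X coincide, so additivity forces any two elements to
be equal. -/
theorem subsingleton_of_isEmpty (X : FinGSet G) [hX : IsEmpty X] : Subsingleton (N.obj X) := by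
  refine ⟨fun a b => ?_⟩
  obtain ⟨z, hz⟩ := (N.additive X X).2 (a, b)
  have h : inl X X = inr X X := by ext x; exact hX.elim x
  have h1 : N.res (inl X X) z = a := congrArg Prod.fst hz
  have h2 : N.res (inr X X) z = b := congrArg Prod.snd hz
  rw [← h1, ← h2, h]

/-- Injectivity says that the square with two identities over f and f is a pullback. -/
theorem res_ind_of_injective {X Y : FinGSet G} (f : X →[G] Y) (hf : Function.Injective f)
    (x : N.obj X) : N.res f (N.ind f x) = x := by
  rw [N.res_ind_apply (MulActionHom.id G) (MulActionHom.id G) f f (fun _ => rfl) ?_ x,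
    N.res_id, N.ind_id]
  · rfl
  · intro a b hab
    exact ⟨a, ⟨rfl, hf hab⟩, fun c hc => hc.1⟩

theorem res_injective {X Y : FinGSet G} (f : X →[G] Y) (hf : Function.Bijective f) :
    Function.Injective (N.res f) := by
  let g : Y →[G] X := f.inverse (Equiv.ofBijective f hf).symm
    (Equiv.ofBijective f hf).left_inv (Equiv.ofBijective f hf).right_inv
  have hg : f.comp g = MulActionHom.id G := by
    ext y
    exact (Equiv.ofBijective f hf).right_inv y
  refine Function.LeftInverse.injective (g := N.res g) fun y => ?_
  rw [← N.res_comp_apply, hg, N.res_id]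
  rfl

theorem ind_res_of_bijective {X Y : FinGSet G} (f : X →[G] Y) (hf : Function.Bijective f)
    (y : N.obj Y) : N.ind f (N.res f y) = y :=
  N.res_injective f hf (N.res_ind_of_injective f hf.1 _)

/-- The pullback is empty, and a Mackey functor vanishes on the empty set. -/
theorem res_ind_of_disjoint {X Y Z : FinGSet G} (f : X →[G] Z) (g : Y →[G] Z)
    (h : ∀ x y, f x ≠ g y) (x : N.obj X) : N.res g (N.ind f x) = 0 := by
  let E : FinGSet G := ofSub (⊥ : SubMulAction G X)
  have hE : IsEmpty E := ⟨fun e => e.2⟩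
  let a : E →[G] X := ⟨fun e => hE.elim e, fun _ e => hE.elim e⟩
  let b : E →[G] Y := ⟨fun e => hE.elim e, fun _ e => hE.elim e⟩
  rw [N.res_ind_apply a b f g (fun e => hE.elim e) (fun x y hxy => (h x y hxy).elim) x]
  have := N.subsingleton_of_isEmpty E
  rw [Subsingleton.elim (N.res a x) 0, map_zero]

theorem eq_of_res_eq {A B Y : FinGSet G} (f : A →[G] Y) (g : B →[G] Y)
    (h : Function.Bijective (Sum.elim f g)) {y z : N.obj Y} (hf : N.res f y = N.res f z)
    (hg : N.res g y = N.res g z) : y = z := by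
  let k : disjUnion A B →[G] Y := ⟨Sum.elim f g, by
    rintro c (a | b)
    · exact map_smul f c a
    · exact map_smul g c b⟩
  refine N.res_injective k h ((N.additive A B).1 (Prod.ext ?_ ?_))
  · change N.res (inl A B) (N.res k y) = N.res (inl A B) (N.res k z)
    rw [← N.res_comp_apply, ← N.res_comp_apply]
    exact hf
  · change N.res (inr A B) (N.res k y) = N.res (inr A B) (N.res k z)
    rw [← N.res_comp_apply, ← N.res_comp_apply]
    exact hg

theorem eq_ind_res_add {A B Y : FinGSet G} (f : A →[G] Y) (g : B →[G] Y)
    (h : Function.Bijective (Sum.elim f g)) (y : N.obj Y) :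
    y = N.ind f (N.res f y) + N.ind g (N.res g y) := by
  have hd : ∀ a b, f a ≠ g b := fun a b hab => by
    simpa using h.1 (a₁ := Sum.inl a) (a₂ := Sum.inr b) hab
  apply N.eq_of_res_eq f g h
  · rw [map_add, N.res_ind_of_injective f (fun a b hab => Sum.inl_injective (h.1 hab)),
      N.res_ind_of_disjoint g f (fun b a => (hd a b).symm), add_zero]
  · rw [map_add, N.res_ind_of_injective g (fun a b hab => Sum.inr_injective (h.1 hab)),
      N.res_ind_of_disjoint f g hd, zero_add]

variable [Finite G]

/-- Restriction to a finite `G`-set `Y` followed by induction, an endomorphism of `N(G)`. -/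
noncomputable def transfer (Y : FinGSet G) :
    Module.End R (N.valueAt (⊤ : Subgroup G)) :=
  N.ind Y.toPoint ∘ₗ N.res Y.toPoint

theorem transfer_apply (Y : FinGSet G) (x : N.valueAt (⊤ : Subgroup G)) :
    N.transfer Y x = N.ind Y.toPoint (N.res Y.toPoint x) := rfl

theorem transfer_quot_apply (H : Subgroup G) (x : N.valueAt (⊤ : Subgroup G)) :
    N.transfer (quot H) x = N.Ind H (N.Res H x) := by
  rw [transfer_apply, hom_point_ext (toPoint _) (quotMap le_top)]

theorem ind_toPoint_ind {X Y : FinGSet G} (f : X →[G] Y) (x : N.obj X) :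
    N.ind Y.toPoint (N.ind f x) = N.ind X.toPoint x := by
  rw [← N.ind_comp_apply, hom_point_ext (Y.toPoint.comp f) X.toPoint]

theorem res_res_toPoint {X Y : FinGSet G} (f : X →[G] Y) (x : N.valueAt (⊤ : Subgroup G)) :
    N.res f (N.res Y.toPoint x) = N.res X.toPoint x := by
  rw [← N.res_comp_apply, hom_point_ext (Y.toPoint.comp f) X.toPoint]

theorem res_toPoint_ind_toPoint (X Y : FinGSet G) (x : N.obj X) :
    N.res Y.toPoint (N.ind X.toPoint x) = N.ind (snd X Y) (N.res (fst X Y) x) :=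
  N.res_ind_apply (fst X Y) (snd X Y) _ _ (fun _ => rfl)
    (fun x y _ => ⟨(x, y), ⟨rfl, rfl⟩, fun _ ht => Prod.ext ht.1 ht.2⟩) x

theorem res_toPoint_ind_toPoint' (X Y : FinGSet G) (y : N.obj Y) :
    N.res X.toPoint (N.ind Y.toPoint y) = N.ind (fst X Y) (N.res (snd X Y) y) :=
  N.res_ind_apply (snd X Y) (fst X Y) _ _ (fun _ => rfl)
    (fun y x _ => ⟨(x, y), ⟨rfl, rfl⟩, fun _ ht => Prod.ext ht.2 ht.1⟩) y

/-- X × Y is the pullback of X and Y over the point. This makes the transfers closed under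
composition, up to splitting X × Y into orbits. -/
theorem transfer_mul (X Y : FinGSet G) :
    N.transfer X * N.transfer Y = N.transfer (prod X Y) := by
  ext x
  rw [Module.End.mul_apply, transfer_apply, transfer_apply, transfer_apply,
    res_toPoint_ind_toPoint', ind_toPoint_ind, res_res_toPoint]

theorem transfer_commute (X Y : FinGSet G) : Commute (N.transfer X) (N.transfer Y) := by
  rw [Commute, SemiconjBy, transfer_mul]
  ext x
  rw [Module.End.mul_apply, transfer_apply, transfer_apply, transfer_apply,
    res_toPoint_ind_toPoint, ind_toPoint_ind, res_res_toPoint]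

theorem ind_toPoint_eq_Ind {Y : FinGSet G} (L : Subgroup G) (f : quot L →[G] Y)
    (hf : Function.Bijective f) (y : N.obj Y) :
    N.ind Y.toPoint y = N.Ind L (N.res f y) := by
  conv_lhs => rw [← N.ind_res_of_bijective f hf y, ind_toPoint_ind]
  rw [hom_point_ext (toPoint _) (quotMap le_top)]

theorem transfer_eq_of_bijective {X Y : FinGSet G} (f : X →[G] Y)
    (hf : Function.Bijective f) : N.transfer Y = N.transfer X := by
  ext x
  rw [transfer_apply, ← N.ind_res_of_bijective f hf (N.res Y.toPoint x), ind_toPoint_ind,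
    res_res_toPoint, transfer_apply]

theorem transfer_eq_add {A B Y : FinGSet G} (f : A →[G] Y) (g : B →[G] Y)
    (h : Function.Bijective (Sum.elim f g)) :
    N.transfer Y = N.transfer A + N.transfer B := by
  ext x
  rw [transfer_apply, N.eq_ind_res_add f g h (N.res Y.toPoint x), map_add, ind_toPoint_ind,
    ind_toPoint_ind, res_res_toPoint, res_res_toPoint]
  rfl

/-- Transfers are additive under disjoint unions, and the transfer of an orbit is that of G modulo a
stabilizer. -/
theorem transfer_mem (S : Submodule R (Module.End R (N.valueAt (⊤ : Subgroup G))))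
    (Y : FinGSet G) (h : ∀ t : Y, N.transfer (quot (MulAction.stabilizer G t)) ∈ S) :
    N.transfer Y ∈ S := by
  revert h
  induction Y using FinGSet.induction_on with
  | empty Y hY =>
    intro _
    have := N.subsingleton_of_isEmpty Y
    have h0 : N.transfer Y = 0 := by
      ext x
      rw [transfer_apply, Subsingleton.elim (N.res Y.toPoint x) 0, map_zero]
      rfl
    rw [h0]
    exact S.zero_mem
  | trans Y hY hY' =>
    intro h
    obtain ⟨t⟩ := hY
    rw [N.transfer_eq_of_bijective _ (orbitMap_stabilizer_bijective t)]
    exact h t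
  | union A B Y f g hfg hA hB =>
    intro h
    rw [N.transfer_eq_add f g hfg]
    refine S.add_mem (hA fun t => ?_) (hB fun t => ?_)
    · have := h (f t)
      rwa [stabilizer_map_of_injective f
        (fun a b hab => Sum.inl_injective (hfg.1 hab)) t] at this
    · have := h (g t)
      rwa [stabilizer_map_of_injective g
        (fun a b hab => Sum.inr_injective (hfg.1 hab)) t] at this

theorem ind_toPoint_mem (W : Submodule R (N.valueAt (⊤ : Subgroup G))) (Y : FinGSet G)
    (h : ∀ t : Y, LinearMap.range (N.Ind (MulAction.stabilizer G t)) ≤ W) (y : N.obj Y) :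
    N.ind Y.toPoint y ∈ W := by
  induction Y using FinGSet.induction_on with
  | empty Y hY =>
    have := N.subsingleton_of_isEmpty Y
    rw [Subsingleton.elim y 0, map_zero]
    exact W.zero_mem
  | trans Y hY hY' =>
    obtain ⟨t⟩ := hY
    rw [N.ind_toPoint_eq_Ind _ _ (orbitMap_stabilizer_bijective t)]
    exact h t ⟨_, rfl⟩
  | union A B Y f g hfg hA hB =>
    rw [N.eq_ind_res_add f g hfg y, map_add, ind_toPoint_ind, ind_toPoint_ind]
    refine W.add_mem (hA (fun t => ?_) _) (hB (fun t => ?_) _)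
    · have := h (f t)
      rwa [stabilizer_map_of_injective f
        (fun a b hab => Sum.inl_injective (hfg.1 hab)) t] at this
    · have := h (g t)
      rwa [stabilizer_map_of_injective g
        (fun a b hab => Sum.inr_injective (hfg.1 hab)) t] at this

end MackeyFunctor

/-! ### Transfers act triangularly on induced elements -/

namespace MackeyFunctor

open FinGSet

variable {R : Type w} [CommRing R] {G : Type u} [Group G] [Finite G]
  (N : MackeyFunctor.{u, v, w} R G)

/-- The part of `N(G)` induced from the members of `F` of order less than `n`. -/
def inducedBelow (F : Set (Subgroup G)) (n : ℕ) : Submodule R (N.valueAt (⊤ : Subgroup G)) :=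
  ⨆ L : {L : Subgroup G // L ∈ F ∧ Nat.card L < n}, LinearMap.range (N.Ind L.1)

theorem range_Ind_le_inducedBelow {F : Set (Subgroup G)} {n : ℕ} {L : Subgroup G} (hL : L ∈ F)
    (hn : Nat.card L < n) : LinearMap.range (N.Ind L) ≤ N.inducedBelow F n :=
  le_iSup (fun L : {L : Subgroup G // L ∈ F ∧ Nat.card L < n} => LinearMap.range (N.Ind L.1))
    ⟨L, hL, hn⟩

/-- Modulo induction from smaller subgroups, pulling back along `q : Y → G / K` and inducing up
to `G` multiplies induction from `K` by the number of `K`-fixed points over the base point. -/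
theorem ind_toPoint_res_sub_mem {F : Set (Subgroup G)} (hF : IsSubgroupFamily F)
    {K : Subgroup G} (hK : K ∈ F) (b : N.valueAt K) (Y : FinGSet G) (q : Y →[G] quot K) :
    N.ind Y.toPoint (N.res q b) -
      Nat.card {t : Y // q t = ((1 : G) : G ⧸ K) ∧ K ≤ MulAction.stabilizer G t} • N.Ind K b ∈
        N.inducedBelow F (Nat.card K) := by
  induction Y using FinGSet.induction_on with
  | empty Y hY =>
    have := N.subsingleton_of_isEmpty Y
    rw [Subsingleton.elim (N.res q b) 0, map_zero, Nat.card_of_isEmpty (α := {t : Y // _}),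
      zero_smul, sub_zero]
    exact Submodule.zero_mem _
  | trans Y hY hY' =>
    by_cases ht : ∃ t : Y, q t = ((1 : G) : G ⧸ K) ∧ K ≤ MulAction.stabilizer G t
    -- A K-fixed point over the base coset gives a section of q. Since Y is transitive, q is an
    -- isomorphism and there is exactly one such point.
    · obtain ⟨t, ht, hKt⟩ := ht
      have hq : ∀ s, q (orbitMap t K hKt s) = s := fun s => by
        induction s using QuotientGroup.induction_on with
        | H a =>
          rw [orbitMap_mk, map_smul, ht]
          change ((a * 1 : G) : G ⧸ K) = _
          rw [mul_one]
      have hbij : Function.Bijective (orbitMap t K hKt) :=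
        ⟨Function.LeftInverse.injective (g := q) hq, orbitMap_surjective t K hKt⟩
      have hcard :
          Nat.card {t : Y // q t = ((1 : G) : G ⧸ K) ∧ K ≤ MulAction.stabilizer G t} = 1 := by
        rw [Nat.card_eq_one_iff_unique]
        refine ⟨⟨?_⟩, ⟨⟨t, ht, hKt⟩⟩⟩
        rintro ⟨s, hs, -⟩ ⟨s', hs', -⟩
        obtain ⟨r, rfl⟩ := hbij.2 s
        obtain ⟨r', rfl⟩ := hbij.2 s'
        rw [hq] at hs hs'
        simp only [hs, hs']
      have hid : q.comp (orbitMap t K hKt) = MulActionHom.id G := by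
        ext s
        exact hq s
      rw [hcard, one_smul, N.ind_toPoint_eq_Ind K _ hbij, ← res_comp_apply, hid, N.res_id]
      simp
    · have : IsEmpty {t : Y // q t = ((1 : G) : G ⧸ K) ∧ K ≤ MulAction.stabilizer G t} :=
        ⟨fun t => ht ⟨t.1, t.2⟩⟩
      rw [Nat.card_of_isEmpty (α := {t : Y // _}), zero_smul, sub_zero]
      obtain ⟨t₀⟩ := hY
      -- Moving t₀ over the base coset puts its stabilizer inside K. Equality would make it a
      -- K-fixed point, so the stabilizer is a smaller member of F.
      obtain ⟨g, hg⟩ := MulAction.exists_smul_eq G (q t₀) ((1 : G) : G ⧸ K)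
      rw [← map_smul] at hg
      have hle : MulAction.stabilizer G (g • t₀) ≤ K := fun k hk => by
        have h1 : k • ((1 : G) : G ⧸ K) = ((1 : G) : G ⧸ K) := by
          rw [← hg, ← map_smul, MulAction.mem_stabilizer_iff.1 hk]
        have h2 : ((k * 1 : G) : G ⧸ K) = ((1 : G) : G ⧸ K) := h1
        rw [mul_one, eq_comm, QuotientGroup.eq] at h2
        simpa using h2
      rw [N.ind_toPoint_eq_Ind _ _ (orbitMap_stabilizer_bijective (g • t₀))]
      refine N.range_Ind_le_inducedBelow (hF.mem_of_le K hK _ hle) ?_ ⟨_, rfl⟩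
      refine lt_of_le_of_ne (Subgroup.card_le_of_le hle) fun h => ht ⟨g • t₀, hg, ?_⟩
      exact (Subgroup.eq_of_le_of_card_ge hle h.ge).ge
  | union A B Y f g hfg hA hB =>
    let e : {t : A ⊕ B // q (Sum.elim f g t) = ((1 : G) : G ⧸ K) ∧
          K ≤ MulAction.stabilizer G (Sum.elim f g t)} ≃
        {t : Y // q t = ((1 : G) : G ⧸ K) ∧ K ≤ MulAction.stabilizer G t} :=
      (Equiv.ofBijective _ hfg).subtypeEquiv fun _ => Iff.rfl
    have h := Submodule.add_mem _ (hA (q.comp f)) (hB (q.comp g))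
    rw [← Nat.card_congr e, Nat.card_congr Equiv.subtypeSum, Nat.card_sum, add_smul,
      N.eq_ind_res_add f g hfg (N.res q b), map_add, ind_toPoint_ind, ind_toPoint_ind,
      ← res_comp_apply, ← res_comp_apply, add_sub_add_comm]
    have hfs : ∀ t, MulAction.stabilizer G (f t) = MulAction.stabilizer G t :=
      stabilizer_map_of_injective f fun a b hab => Sum.inl_injective (hfg.1 hab)
    have hgs : ∀ t, MulAction.stabilizer G (g t) = MulAction.stabilizer G t :=
      stabilizer_map_of_injective g fun a b hab => Sum.inr_injective (hfg.1 hab)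
    simp only [Sum.elim_inl, Sum.elim_inr, hfs, hgs]
    exact h

/-- Apply the preceding count to the projection G/H × G/K → G/K: the base coset of G/K is itself
fixed by K, so the K-fixed points above it are the K-fixed points of G/H. -/
theorem transfer_Ind_sub_mem {F : Set (Subgroup G)} (hF : IsSubgroupFamily F)
    (H : Subgroup G) {K : Subgroup G} (hK : K ∈ F) (b : N.valueAt K) :
    N.transfer (quot H) (N.Ind K b) -
      Nat.card {s : G ⧸ H // K ≤ MulAction.stabilizer G s} • N.Ind K b ∈
        N.inducedBelow F (Nat.card K) := by
  have h := N.ind_toPoint_res_sub_mem hF hK b (prod (quot H) (quot K)) (snd _ _)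
  have hcard : Nat.card {t : prod (quot H) (quot K) //
      snd (quot H) (quot K) t = ((1 : G) : G ⧸ K) ∧ K ≤ MulAction.stabilizer G t} =
      Nat.card {s : G ⧸ H // K ≤ MulAction.stabilizer G s} := by
    refine Nat.card_congr
      ⟨fun t => ⟨t.1.1, fun k hk => congrArg Prod.fst (t.2.2 hk)⟩,
        fun s => ⟨(s.1, ((1 : G) : G ⧸ K)), rfl, fun k hk => Prod.ext (s.2 hk) ?_⟩, ?_, ?_⟩
    · change ((k * 1 : G) : G ⧸ K) = _
      rw [mul_one, eq_comm, QuotientGroup.eq]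
      simpa using hk
    · rintro ⟨⟨s, t⟩, ht, -⟩
      exact Subtype.ext (Prod.ext rfl ht.symm)
    · exact fun s => rfl
  rw [hcard, ← ind_toPoint_ind N (fst _ _), ← res_toPoint_ind_toPoint',
    hom_point_ext (toPoint (quot K)) (quotMap le_top)] at h
  exact h

end MackeyFunctor

/-! ### Fixed points and p-extensions -/

theorem IsSubgroupFamily.stabilizer_quotient_mem {G : Type*} [Group G] {F : Set (Subgroup G)}
    (hF : IsSubgroupFamily F) {H : Subgroup G} (hH : H ∈ F) (s : G ⧸ H) :
    MulAction.stabilizer G s ∈ F := by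
  induction s using QuotientGroup.induction_on with
  | H g =>
    have hg : ((g : G) : G ⧸ H) = g • ((1 : G) : G ⧸ H) := by
      change _ = ((g * 1 : G) : G ⧸ H)
      rw [mul_one]
    rw [hg, MulAction.stabilizer_smul_eq_stabilizer_map_conj, MulAction.stabilizer_quotient]
    exact hF.conj_mem H hH g

/-- A `p`-extension does not change the number of fixed points modulo `p`. -/
theorem card_fixed_modEq_of_mem_pExtensions {G : Type*} [Group G] {p : ℕ} [Fact p.Prime]
    {K H : Subgroup G} (h : H ∈ pExtensions p K) (Y : Type*) [MulAction G Y] [Finite Y] [Finite G] :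
    Nat.card {y : Y // K ≤ MulAction.stabilizer G y} ≡
      Nat.card {y : Y // H ≤ MulAction.stabilizer G y} [MOD p] := by
  obtain ⟨hKH, hn, hp⟩ := h
  -- The p-group H/K acts on the K-fixed points, and its fixed points there are the H-fixed points.
  have key := hp.card_modEq_card_fixedPoints (MulAction.fixedPoints (K.subgroupOf H) Y)
  have e1 : Nat.card {y : Y // K ≤ MulAction.stabilizer G y} =
      Nat.card (MulAction.fixedPoints (K.subgroupOf H) Y) := by
    refine Nat.card_congr (Equiv.subtypeEquivRight fun y => ?_)
    exact ⟨fun h k => h (Subgroup.mem_subgroupOf.1 k.2), fun h k hk =>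
      h ⟨⟨k, hKH hk⟩, hk⟩⟩
  have e2 : Nat.card {y : Y // H ≤ MulAction.stabilizer G y} =
      Nat.card (MulAction.fixedPoints (H ⧸ K.subgroupOf H)
        (MulAction.fixedPoints (K.subgroupOf H) Y)) := by
    refine Nat.card_congr ⟨fun y => ⟨⟨y.1, fun k => y.2 k.1.2⟩, fun q => ?_⟩,
      fun y => ⟨y.1.1, fun g hg => ?_⟩, fun y => rfl, fun y => rfl⟩
    · induction q using QuotientGroup.induction_on with
      | H a => exact Subtype.ext (y.2 a.2)
    · exact congrArg Subtype.val (y.2 ((⟨g, hg⟩ : H) : H ⧸ K.subgroupOf H))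
  rw [e1, e2]
  exact key

/-- If `p` divides the number of `K`-fixed points of `G / K`, then `K` has a proper
`p`-extension. -/
theorem exists_lt_mem_pExtensions {G : Type*} [Group G] [Finite G] {p : ℕ} [Fact p.Prime]
    {K : Subgroup G} (h : p ∣ Nat.card {s : G ⧸ K // K ≤ MulAction.stabilizer G s}) :
    ∃ H ∈ pExtensions p K, K < H := by
  have e : Nat.card {s : G ⧸ K // K ≤ MulAction.stabilizer G s} =
      Nat.card (MulAction.fixedPoints K (G ⧸ K)) :=
    Nat.card_congr (Equiv.subtypeEquivRight fun y => ⟨fun h k => h k.2, fun h k hk => h ⟨k, hk⟩⟩)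
  -- The K-fixed points of G/K form N(K)/K. Cauchy's theorem gives an element x of order p, and the
  -- preimage of the subgroup it generates is the extension sought.
  rw [e, Nat.card_congr (Sylow.fixedPointsMulLeftCosetsEquivQuotient K)] at h
  have hnormal : (K.comap (Subgroup.normalizer (K : Set G)).subtype).Normal :=
    Subgroup.normal_subgroupOf_of_le_normalizer le_rfl
  obtain ⟨x, hx⟩ := exists_prime_orderOf_dvd_card' p h
  let N := Subgroup.normalizer (K : Set G)
  let H' : Subgroup N := (Subgroup.zpowers x).comap (QuotientGroup.mk' (K.comap N.subtype))
  have hpow : ∀ g ∈ H', ((g : G)) ^ p ∈ K := fun g hg => by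
    have h1 : (QuotientGroup.mk' (K.comap N.subtype) g) ^ p = 1 := by
      obtain ⟨k, hk⟩ := Subgroup.mem_zpowers_iff.1 (Subgroup.mem_comap.1 hg)
      rw [← hk, ← zpow_natCast, ← zpow_mul, mul_comm, zpow_mul, zpow_natCast, ← hx,
        pow_orderOf_eq_one, one_zpow]
    rw [← map_pow] at h1
    exact (QuotientGroup.eq_one_iff (g ^ p)).1 h1
  have hKH : K ≤ H'.map N.subtype := fun k hk => by
    refine ⟨⟨k, Subgroup.le_normalizer hk⟩, ?_, rfl⟩
    have h1 : QuotientGroup.mk' (K.comap N.subtype) ⟨k, Subgroup.le_normalizer hk⟩ = 1 :=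
      (QuotientGroup.eq_one_iff _).2 hk
    exact Subgroup.mem_comap.2 (h1 ▸ Subgroup.one_mem _)
  have hn : (K.subgroupOf (H'.map N.subtype)).Normal :=
    Subgroup.normal_subgroupOf_of_le_normalizer (Subgroup.map_subtype_le H')
  refine ⟨H'.map N.subtype, ⟨hKH, hn, ?_⟩, lt_of_le_of_ne hKH ?_⟩
  · intro q
    refine ⟨1, ?_⟩
    induction q using QuotientGroup.induction_on with
    | H a =>
      obtain ⟨_, g, hg, rfl⟩ := a
      rw [pow_one]
      exact (QuotientGroup.eq_one_iff _).2 (hpow g hg)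
  · intro hKH'
    obtain ⟨g, rfl⟩ := QuotientGroup.mk'_surjective _ x
    have hg : (g : G) ∈ K :=
      hKH'.ge ⟨g, Subgroup.mem_comap.2 (Subgroup.mem_zpowers _), rfl⟩
    rw [show QuotientGroup.mk' (K.comap N.subtype) g = 1 from (QuotientGroup.eq_one_iff _).2 hg,
      orderOf_one] at hx
    exact (Fact.out : p.Prime).one_lt.ne hx

/-- For a `hyper_p`-closed set `F` of subgroups and `K ∈ F`, some `G / H` with `H ∈ F` has a
number of `K`-fixed points prime to `p`. -/
theorem exists_not_dvd_card_fixed {G : Type*} [Group G] [Finite G] {p : ℕ} [Fact p.Prime]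
    {F : Set (Subgroup G)} (hp : IsHyperClosed p F) {K : Subgroup G} (hK : K ∈ F) :
    ∃ H ∈ F, ¬ p ∣ Nat.card {s : G ⧸ H // K ≤ MulAction.stabilizer G s} := by
  -- Climb through proper p-extensions inside F; the climb stops because G is finite.
  induction K using WellFoundedGT.induction with
  | ind K ih =>
    by_cases h : p ∣ Nat.card {s : G ⧸ K // K ≤ MulAction.stabilizer G s}
    · obtain ⟨L, hL, hKL⟩ := exists_lt_mem_pExtensions h
      obtain ⟨H, hH, hd⟩ := ih L hKL (hp K hK hL)
      exact ⟨H, hH, fun h' =>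
        hd (((card_fixed_modEq_of_mem_pExtensions hL (G ⧸ H)).dvd_iff dvd_rfl).1 h')⟩
    · exact ⟨K, hK, h⟩

/-! ### The span of the transfers from F contains the identity -/

namespace MackeyFunctor

open FinGSet

variable {R : Type w} [CommRing R] {G : Type u} [Group G] [Finite G]
  (N : MackeyFunctor.{u, v, w} R G)

/-- The span of the endomorphisms `Ind_H ∘ Res_H` of `N(G)`, for `H ∈ F`. -/
def transferSpan (F : Set (Subgroup G)) :
    Submodule R (Module.End R (N.valueAt (⊤ : Subgroup G))) :=
  Submodule.span R (Set.range fun H : F => N.transfer (quot (H : Subgroup G)))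

variable {N}

theorem transfer_mem_transferSpan {F : Set (Subgroup G)} {H : Subgroup G} (hH : H ∈ F) :
    N.transfer (quot H) ∈ N.transferSpan F :=
  Submodule.subset_span ⟨⟨H, hH⟩, rfl⟩

theorem mul_mem_transferSpan {F : Set (Subgroup G)} (hF : IsSubgroupFamily F)
    {s t : Module.End R (N.valueAt (⊤ : Subgroup G))} (hs : s ∈ N.transferSpan F)
    (ht : t ∈ N.transferSpan F) : s * t ∈ N.transferSpan F := by
  have h := Submodule.mul_mem_mul hs ht
  rw [transferSpan, Submodule.span_mul_span] at h
  refine Submodule.span_le.2 ?_ h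
  rintro _ ⟨_, ⟨⟨H, hH⟩, rfl⟩, _, ⟨⟨K, hK⟩, rfl⟩, rfl⟩
  change N.transfer (quot H) * N.transfer (quot K) ∈ N.transferSpan F
  rw [transfer_mul]
  refine N.transfer_mem _ _ fun t => transfer_mem_transferSpan ?_
  -- The stabilizer of a pair lies in that of its first coordinate, a conjugate of H.
  exact hF.mem_of_le _ (hF.stabilizer_quotient_mem hH t.1) _ fun g hg => congrArg Prod.fst hg

theorem commute_of_mem_transferSpan {F : Set (Subgroup G)}
    {s t : Module.End R (N.valueAt (⊤ : Subgroup G))} (hs : s ∈ N.transferSpan F)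
    (ht : t ∈ N.transferSpan F) : Commute s t := by
  induction hs, ht using Submodule.span_induction₂ with
  | mem_mem x y hx hy =>
    obtain ⟨H, rfl⟩ := hx
    obtain ⟨K, rfl⟩ := hy
    exact N.transfer_commute _ _
  | zero_left y hy => exact Commute.zero_left y
  | zero_right x hx => exact Commute.zero_right x
  | add_left x y z _ _ _ h h' => exact h.add_left h'
  | add_right x y z _ _ _ h h' => exact h.add_right h'
  | smul_left r x y _ _ h => exact h.smul_left r
  | smul_right r x y _ _ h => exact h.smul_right r

/-- Finitely many submodules killed by elements of `1 - transferSpan` have a sum that is killed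
by a single one. -/
theorem exists_fixes_iSup {F : Set (Subgroup G)} (hF : IsSubgroupFamily F) {ι : Type*} [Finite ι]
    (W : ι → Submodule R (N.valueAt (⊤ : Subgroup G)))
    (h : ∀ i, ∃ s ∈ N.transferSpan F, ∀ x ∈ W i, s x = x) :
    ∃ s ∈ N.transferSpan F, ∀ x ∈ ⨆ i, W i, s x = x := by
  classical
  have := Fintype.ofFinite ι
  suffices ∀ A : Finset ι, ∃ s ∈ N.transferSpan F, ∀ i ∈ A, ∀ x ∈ W i, s x = x by
    obtain ⟨s, hs, hsx⟩ := this Finset.univ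
    refine ⟨s, hs, fun x hx => ?_⟩
    have hle : ⨆ i, W i ≤ LinearMap.eqLocus s 1 := iSup_le fun i x hx =>
      hsx i (Finset.mem_univ i) x hx
    exact hle hx
  intro A
  induction A using Finset.induction_on with
  | empty => exact ⟨0, Submodule.zero_mem _, by simp⟩
  | insert i A hi ih =>
    obtain ⟨s, hs, hsx⟩ := ih
    obtain ⟨t, ht, htx⟩ := h i
    -- This is 1 - (1 - s)(1 - t). As s and t commute, either factor can be applied first.
    refine ⟨s + t - s * t, Submodule.sub_mem _ (Submodule.add_mem _ hs ht)
      (mul_mem_transferSpan hF hs ht), fun j hj x hx => ?_⟩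
    rcases Finset.mem_insert.1 hj with rfl | hj
    · simp [htx x hx]
    · rw [(commute_of_mem_transferSpan hs ht).eq]
      simp [hsx j hj x hx]

/-- Some rescaled transfer t is the identity on the image of Ind_K up to terms from smaller members
of F. With s fixing all those terms, (1 - s)(1 - t) kills the image. -/
theorem exists_fixes_range_Ind {F : Set (Subgroup G)} (hF : IsSubgroupFamily F) {p : ℕ}
    [Fact p.Prime] (hp : IsHyperClosed p F) (hR : ∀ n : ℕ, ¬ p ∣ n → IsUnit (n : R))
    {K : Subgroup G} (hK : K ∈ F) :
    ∃ s ∈ N.transferSpan F, ∀ x ∈ LinearMap.range (N.Ind K), s x = x := by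
  obtain ⟨n, hn⟩ : ∃ n, Nat.card K = n := ⟨_, rfl⟩
  induction n using Nat.strong_induction_on generalizing K with
  | _ n ih =>
    subst hn
    obtain ⟨s, hs, hsx⟩ := exists_fixes_iSup hF
      (fun L : {L : Subgroup G // L ∈ F ∧ Nat.card L < Nat.card K} =>
        LinearMap.range (N.Ind L.1)) fun L => ih _ L.2.2 L.2.1 rfl
    obtain ⟨H, hH, hd⟩ := exists_not_dvd_card_fixed hp hK
    obtain ⟨c, hc⟩ := hR _ hd
    let t := (↑c⁻¹ : R) • N.transfer (quot H)
    have ht : t ∈ N.transferSpan F :=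
      Submodule.smul_mem _ _ (transfer_mem_transferSpan hH)
    refine ⟨s + t - s * t, Submodule.sub_mem _ (Submodule.add_mem _ hs ht)
      (mul_mem_transferSpan hF hs ht), ?_⟩
    rintro _ ⟨b, rfl⟩
    -- After cancelling the unit c, this says that s fixes t(Ind_K b) - Ind_K b.
    have h := hsx _ (Submodule.smul_mem _ (↑c⁻¹ : R) (N.transfer_Ind_sub_mem hF H hK b))
    rw [← Nat.cast_smul_eq_nsmul R, ← hc, smul_sub, smul_smul, c.inv_mul, one_smul, map_sub] at h
    change s (t (N.Ind K b)) - s (N.Ind K b) = t (N.Ind K b) - N.Ind K b at h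
    simp only [LinearMap.sub_apply, LinearMap.add_apply, Module.End.mul_apply]
    rw [sub_eq_sub_iff_add_eq_add] at h
    rw [sub_eq_iff_eq_add, add_comm (s _), ← h, add_comm]

/-- If `N(G)` is induced from a `hyper_p`-closed family, then the identity of `N(G)` is a
combination of the `Ind_H ∘ Res_H`. -/
theorem one_mem_transferSpan {F : Set (Subgroup G)} (hF : IsSubgroupFamily F) {p : ℕ}
    [Fact p.Prime] (hp : IsHyperClosed p F) (hR : ∀ n : ℕ, ¬ p ∣ n → IsUnit (n : R))
    (htop : ⨆ H : F, LinearMap.range (N.Ind (H : Subgroup G)) = ⊤) :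
    1 ∈ N.transferSpan F := by
  obtain ⟨s, hs, hsx⟩ := exists_fixes_iSup hF
    (fun H : F => LinearMap.range (N.Ind (H : Subgroup G)))
    fun H => exists_fixes_range_Ind hF hp hR H.2
  have : s = 1 := by
    ext x
    exact hsx x (htop ▸ Submodule.mem_top)
  exact this ▸ hs

end MackeyFunctor

/-! ### Induction from F by means of the Green ring -/

namespace MackeyFunctor

open FinGSet

section

variable {R : Type w} [CommRing R] {G : Type u} [Group G] (N : MackeyFunctor.{u, v, w} R G)

/-- A contraction of the Amitsur complex of inductions makes its last map surjective. -/
theorem ind_dropCoord_surjective (X : FinGSet G)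
    (h : Nonempty (Homotopy (𝟙 (N.amitsurInd X)) 0)) :
    Function.Surjective (N.ind (X.dropCoord 0 0)) := by
  obtain ⟨h⟩ := h
  have h0 := h.comm 0
  -- In degree 0 only one term of the homotopy formula survives, so the contraction is a section of
  -- the last boundary map.
  rw [Homotopy.dNext_zero_chainComplex, Homotopy.prevD_chainComplex] at h0
  intro y
  have hd : (N.amitsurInd X).d 1 0 = ModuleCat.ofHom (N.amitsurIndD X 0) :=
    ChainComplex.of_d (fun n => ModuleCat.of R (N.obj (X.pow n)))
      (fun n => ModuleCat.ofHom (N.amitsurIndD X n)) 0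
  have hD : N.amitsurIndD X 0 = N.ind (X.dropCoord 0 0) := by
    simp [amitsurIndD]
  refine ⟨(h.hom 0 1).hom y, ?_⟩
  have := congrArg (fun f => f.hom y) h0
  simp [hd, hD] at this
  exact this.symm

end

section

variable {R : Type w} [CommRing R] {G : Type u} [Group G]

/-- If a Green ring acts on `M` and the unit of the Green ring is, after base change to `A`,
induced from a `G`-set `Y`, then so is everything in `A ⊗ M(G)`. -/
theorem mem_of_ind_eq_one {𝒢 : GreenFunctor.{u, v, w} R G} {M : MackeyFunctor R G}
    (act : GreenAction 𝒢 M) (A : Type w) [CommRing A] [Algebra R A] {Y Z : FinGSet G}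
    (f : Y →[G] Z) (b : A ⊗[R] 𝒢.toMackey.obj Y)
    (hb : (𝒢.toMackey.ind f).baseChange A b = 1 ⊗ₜ 𝒢.one Z) (z : A ⊗[R] M.obj Z) :
    z ∈ LinearMap.range ((M.ind f).baseChange A) := by
  induction z using TensorProduct.induction_on with
  | zero => exact Submodule.zero_mem _
  | add z z' h h' => exact Submodule.add_mem _ h h'
  | tmul a m =>
    -- Since b need not be a pure tensor, Frobenius reciprocity is stated as an equality of maps
    -- linear in the Green ring element, which can be base changed and evaluated at b.
    have hflip : (act.smul Z).flip m ∘ₗ 𝒢.toMackey.ind f =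
        M.ind f ∘ₗ (act.smul Y).flip (M.res f m) := by
      ext c
      exact act.ind_smul f c m
    have h := congrArg (fun g => g.baseChange A b) hflip
    simp only [LinearMap.baseChange_comp, LinearMap.comp_apply, hb, LinearMap.baseChange_tmul,
      LinearMap.flip_apply, act.one_smul] at h
    have ha : a ⊗ₜ[R] m = a • ((1 : A) ⊗ₜ[R] m) := by
      rw [TensorProduct.smul_tmul', smul_eq_mul, mul_one]
    rw [ha, h]
    exact Submodule.smul_mem _ _ ⟨_, rfl⟩

variable [Finite G]

/-- If a Green ring acts on `M` and is `F`-computable over `A`, then `A ⊗ M(G)` is induced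
from `F`. -/
theorem iSup_range_Ind_eq_top {𝒢 : GreenFunctor.{u, v, w} R G} {M : MackeyFunctor R G}
    (act : GreenAction 𝒢 M) (A : Type w) [CommRing A] [Algebra R A] {F : Set (Subgroup G)}
    (hF : IsSubgroupFamily F) (h : (𝒢.toMackey.baseChange A).IsComputable F) :
    ⨆ H : F, LinearMap.range ((M.baseChange A).Ind (H : Subgroup G)) = ⊤ := by
  rw [eq_top_iff]
  intro x _
  let X := ofFamily F
  obtain ⟨b, hb⟩ := (𝒢.toMackey.baseChange A).ind_dropCoord_surjective X h.2
    (1 ⊗ₜ 𝒢.one (X.pow 0))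
  -- The Amitsur complex ends at the one-point set X⁰ rather than at G/G, so x is transported along
  -- this isomorphism.
  have hbij : Function.Bijective (toPoint (X.pow 0)) := by
    refine ⟨fun s t _ => Subsingleton.elim (α := Fin 0 → X) s t, fun s => ⟨Fin.elim0, ?_⟩⟩
    exact QuotientGroup.subsingleton_quotient_top.elim _ _
  obtain ⟨y, hy⟩ : ∃ y : (M.baseChange A).obj (X.pow 1),
      (M.baseChange A).ind (X.dropCoord 0 0) y = (M.baseChange A).res (toPoint (X.pow 0)) x :=
    mem_of_ind_eq_one act A _ b hb ((M.baseChange A).res (toPoint (X.pow 0)) x)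
  rw [← (M.baseChange A).ind_res_of_bijective _ hbij x, ← hy, ind_toPoint_ind]
  refine (M.baseChange A).ind_toPoint_mem _ _ (fun t => ?_) y
  refine le_iSup (fun H : F => LinearMap.range ((M.baseChange A).Ind (H : Subgroup G)))
    ⟨MulAction.stabilizer G t, ?_⟩
  -- A point of X¹ is a coset of some H ∈ F, so its stabilizer lies in a conjugate of H.
  refine hF.mem_of_le _ (hF.stabilizer_quotient_mem (t 0).1.2 (t 0).2) _ fun g hg => ?_
  have h0 : g • t 0 = t 0 := congrFun hg 0
  exact eq_of_heq (Sigma.mk.inj h0).2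

end

end MackeyFunctor

/-! ### Specialization to ℤ_(p) -/

theorem IntLocal.isUnit_natCast {p : ℕ} [Fact p.Prime] (n : ℕ) (h : ¬ p ∣ n) :
    IsUnit (n : IntLocal p) := by
  have := (IsLocalization.AtPrime.isUnit_to_map_iff (IntLocal p) (Ideal.span {(p : ℤ)}) (n : ℤ)).2
    fun hn => h (by simpa [Ideal.mem_span_singleton, Int.natCast_dvd_natCast] using hn)
  simpa using this

theorem mainTheorem4 {G : Type u} [Group G] [Finite G] (p : ℕ) [Fact p.Prime]
    (𝒢 : GreenFunctor.{u, v} ℤ G) (ℳ : MackeyFunctor.{u, w} ℤ G) (_act : GreenAction 𝒢 ℳ)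
    (F : Set (Subgroup G)) (_hF : IsSubgroupFamily F) (_hp : IsHyperClosed p F)
    (_hcomp : (𝒢.toMackey.baseChange (IntLocal p)).IsComputable F)
    (x : (ℳ.baseChange (IntLocal p)).valueAt (⊤ : Subgroup G)) :
    ∃ a : F → IntLocal p,
      x = ∑ᶠ H : F, a H • (ℳ.baseChange (IntLocal p)).Ind (H : Subgroup G)
        ((ℳ.baseChange (IntLocal p)).Res (H : Subgroup G) x) := by
  have := Fintype.ofFinite F
  have h1 := MackeyFunctor.one_mem_transferSpan (N := ℳ.baseChange (IntLocal p)) _hF _hp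
    IntLocal.isUnit_natCast
    (MackeyFunctor.iSup_range_Ind_eq_top _act (IntLocal p) _hF _hcomp)
  obtain ⟨a, ha⟩ := (Submodule.mem_span_range_iff_exists_fun _).1 h1
  refine ⟨a, ?_⟩
  rw [finsum_eq_sum_of_fintype]
  have hx := LinearMap.congr_fun ha x
  simp only [LinearMap.sum_apply, LinearMap.smul_apply, Module.End.one_apply,
    MackeyFunctor.transfer_quot_apply] at hx
  exact hx.symm
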